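/- Let $n\ge 1$ and $[n]=\{1,\dots,n\}$. A plane permutation on $[n]$ is a pair $\mathfrak p=(s,\pi)$, where $s=(s_0~s_1~\cdots~s_{n-1})$ is an $n$-cycle and $\pi$ is an arbitrary permutation of $[n]$; its diagonal is $D_{\mathfrak p}=s\circ\pi^{-1}$, and its cycles are the cycles of $\pi$ (fixed points included). Write $x<_s y$ if $x$ appears before $y$ in the sequence $s_0,s_1,\dots,s_{n-1}$. An element $x\in[n]$ is an exceedance of $\mathfrak p$ if $x<_s\pi(x)$, and $\mathrm{Exc}(\mathfrak p)$ is the number of exceedances of $\mathfrak p$; for this count each cycle $s$ may be written starting from any of its elements $s_0$. Let $D$ be any permutation of $[n]$, and let $\lambda$ be its cycle-type. For $k\ge 1$ and $a\ge 0$ let $p^{\lambda}_{k}(n)$ be the number of plane permutations on $[n]$ with diagonal $D$ and exactly $k$ cycles, and let $p^{\lambda}_{a,k}(n)$ be the number of those among them with $\mathrm{Exc}(\mathfrak p)=a$. Then for every $k\ge 1$ $$\sum_{a\ge 0}(n-a-k)\,p^{\lambda}_{a,k}(n)=\sum_{i\ge 1}\binom{k+2i}{k-1}\,p^{\lambda}_{k+2i}(n),$$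 where all but finitely many terms on each side are zero. -/

import Mathlib

/-- A plane permutation on an `n`-element set: a pair `(s, π)` where `s` is an `n`-cycle
(all of `Fin n` is a single orbit of `s`, so that the identity is the `1`-cycle on `Fin 1`)
and `π` is an arbitrary permutation. -/
@[ext]
structure PlanePermutation (n : ℕ) where
  /-- the `n`-cycle `s` -/
  s : Equiv.Perm (Fin n)
  /-- the arbitrary permutation `π` -/
  π : Equiv.Perm (Fin n)
  /-- `s` is an `n`-cycle -/
  isCycleOn : s.IsCycleOn Set.univ

namespace PlanePermutation

variable {n : ℕ}

instance : Finite (PlanePermutation n) :=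
  Finite.of_injective (fun p : PlanePermutation n => (p.s, p.π)) (by
    intro p q h
    have h' := Prod.mk.inj h
    exact PlanePermutation.ext h'.1 h'.2)

/-- The diagonal `D = s ∘ π⁻¹`; it sends `π (s_{i-1})` to `s_i`, indices modulo `n`. -/
def diagonal (p : PlanePermutation n) : Equiv.Perm (Fin n) := p.s * p.π⁻¹

theorem diagonal_apply (p : PlanePermutation n) (x : Fin n) :
    p.diagonal (p.π x) = p.s x := by
  simp [diagonal]

/-- The number of cycles of `p`, i.e. of `π`, fixed points counted as cycles. -/
def numCycles (p : PlanePermutation n) : ℕ := p.π.partition.parts.card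

/-- The position of `x` when `s` is written as `(s₀ s₁ ⋯ s_{n-1})` with leftmost element `s₀`:
the least `m` with `s ^ m` sending `s₀` to `x`. -/
noncomputable def position (p : PlanePermutation n) (s₀ x : Fin n) : ℕ :=
  sInf {m : ℕ | (p.s ^ m) s₀ = x}

theorem pow_position (p : PlanePermutation n) (s₀ x : Fin n) :
    (p.s ^ p.position s₀ x) s₀ = x := by
  have h : p.s.SameCycle s₀ x := p.isCycleOn.2 (Set.mem_univ _) (Set.mem_univ _)
  obtain ⟨m, -, hm⟩ := h.exists_pow_eq'
  exact Nat.sInf_mem (s := {m : ℕ | (p.s ^ m) s₀ = x}) ⟨m, hm⟩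

/-- The order `a <_s b`: `a` appears before `b` when `s` is written with leftmost element `s₀`. -/
def before (p : PlanePermutation n) (s₀ a b : Fin n) : Prop :=
  p.position s₀ a < p.position s₀ b

open Classical in
/-- The number of exceedances of `p`, i.e. of elements `x` with `x <_s π x`, when `s` is written
with leftmost element `s₀`. -/
noncomputable def exc (p : PlanePermutation n) (s₀ : Fin n) : ℕ :=
  (Finset.univ.filter fun x : Fin n => p.before s₀ x (p.π x)).card

/-- The number of plane permutations with diagonal `D` and `k` cycles. -/
noncomputable def countCycles (D : Equiv.Perm (Fin n)) (k : ℕ) : ℕ :=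
  Set.ncard {p : PlanePermutation n | p.diagonal = D ∧ p.numCycles = k}

/-- The number of plane permutations with diagonal `D`, `k` cycles and `a` exceedances, where the
cycle `s` of each plane permutation `p` is written with leftmost element `base p`. -/
noncomputable def countExcCycles (base : PlanePermutation n → Fin n)
    (D : Equiv.Perm (Fin n)) (a k : ℕ) : ℕ :=
  Set.ncard {p : PlanePermutation n | p.diagonal = D ∧ p.numCycles = k ∧ p.exc (base p) = a}

theorem exc_le (p : PlanePermutation n) (s₀ : Fin n) : p.exc s₀ ≤ n := by
  unfold exc
  exact (Finset.card_le_univ _).trans_eq (Fintype.card_fin n)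

theorem numCycles_le (p : PlanePermutation n) : p.numCycles ≤ n := by
  have h : p.π.partition.parts.card ≤ p.π.partition.parts.sum := by
    have := Multiset.card_nsmul_le_sum (s := p.π.partition.parts) (a := 1)
      (fun x hx => p.π.partition.parts_pos hx)
    simpa using this
  exact h.trans (p.π.partition.parts_sum.trans (Fintype.card_fin n)).le

/-- Only finitely many of the numbers of the family are nonzero, as `a` varies. -/
theorem countExcCycles_eq_zero (base : PlanePermutation n → Fin n)
    (D : Equiv.Perm (Fin n)) {a : ℕ} (k : ℕ) (ha : n < a) :
    countExcCycles base D a k = 0 := by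
  have h : {p : PlanePermutation n |
      p.diagonal = D ∧ p.numCycles = k ∧ p.exc (base p) = a} = ∅ := by
    ext p
    simp only [Set.mem_ofPred_eq, Set.mem_empty_iff_false, iff_false]
    rintro ⟨-, -, h⟩
    have := p.exc_le (base p)
    omega
  rw [countExcCycles, h, Set.ncard_empty]

/-- Only finitely many of the numbers of the family are nonzero, as `k` varies. -/
theorem countCycles_eq_zero (D : Equiv.Perm (Fin n)) {k : ℕ} (hk : n < k) :
    countCycles D k = 0 := by
  have h : {p : PlanePermutation n | p.diagonal = D ∧ p.numCycles = k} = ∅ := by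
    ext p
    simp only [Set.mem_ofPred_eq, Set.mem_empty_iff_false, iff_false]
    rintro ⟨-, h⟩
    have := p.numCycles_le
    omega
  rw [countCycles, h, Set.ncard_empty]

end PlanePermutation

/-!
Fix a leftmost element `b` for all the cycles `s`; the number of exceedances does not depend on it
(`exc_eq_exc`). Call `v` an *anti-exceedance value* of `(s, π)` if `v` is not after `π⁻¹ v` in `s`.
There are `n - Exc` of these, and the least element of each cycle is one of them, so `n - a - k`
counts the *nontrivial* ones, those that are not the least element of their cycle.

For `x <_s y <_s z`, multiplying both `s` and `π` on the right by the three-cycle `x ↦ y ↦ z ↦ x`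
exchanges two adjacent blocks of `s` (`blockTranspose`), so the result is a plane permutation with
the same diagonal. Suppose that `x` and `y` are the least elements of their cycles, that these lie,
with `x` before `y`, before the whole cycle of a third element `v`, and that `v` is an
anti-exceedance value. Then the block transposition at `x`, `y`, `v` glues the three cycles into one
with least element `x`, on which `v` is a nontrivial anti-exceedance value; the cycles with least
element before `x` are not affected. Every plane permutation with a marked nontrivial
anti-exceedance value `v` arises exactly once in this way: `x` is the least element of the cycle of
`v`, and `y` is the first element of `s` after `v` among those on the arc of `π` from `x` to `v`
(`glue_injective`, `exists_glue_eq`).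

On the side with three cycles the value `v` need not be nontrivial. If it is the least element of
its cycle, one has just chosen three cycles; if it is not, the construction can be iterated with two
cycles set aside. Keeping track of `j` cycles set aside, which lie before the cycle of `v`, gives
the recursion `markedCount_eq`,
`F(k, j) = C(k + 2, j + 3) p_{k+2} + F(k + 2, j + 2)`,
whose solution at `j = 0` is the sum of the terms `C(k + 2i, 2i + 1) p_{k+2i}`.
-/

/-! ### Cycles of a permutation multiplied by a three-cycle -/

namespace Equiv.Perm

open _root_.Finset

variable {α : Type*}

/-- On a cycle through `x`, `z` and a third point `y`, either `z` or `x` is met first when walking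
backwards from `y`. -/
theorem not_exists_pow_avoiding {σ : Perm α} {x y z : α} {i j : ℕ}
    (hi : (σ ^ i) x = y) (hiz : ∀ m ≤ i, (σ ^ m) x ≠ z)
    (hj : (σ ^ j) z = y) (hjx : ∀ m ≤ j, (σ ^ m) z ≠ x) : False := by
  rcases le_total i j with h | h
  · refine hjx (j - i) (by omega) ((σ ^ i).injective ?_)
    rw [← mul_apply, ← pow_add, Nat.add_sub_cancel' h, hi, hj]
  · refine hiz (i - j) (by omega) ((σ ^ j).injective ?_)
    rw [← mul_apply, ← pow_add, Nat.add_sub_cancel' h, hi, hj]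

variable [DecidableEq α]

/-- The three-cycle `x ↦ y ↦ z ↦ x` (for distinct `x`, `y`, `z`). -/
def threeCycle (x y z : α) : Perm α := swap x y * swap y z

theorem threeCycle_apply_fst {x y z : α} (hxy : x ≠ y) (hxz : x ≠ z) :
    threeCycle x y z x = y := by
  simp [threeCycle, swap_apply_of_ne_of_ne hxy hxz]

theorem threeCycle_apply_snd {x y z : α} (hyz : y ≠ z) (hxz : x ≠ z) :
    threeCycle x y z y = z := by
  simp [threeCycle, swap_apply_of_ne_of_ne hxz.symm hyz.symm]

theorem threeCycle_apply_trd (x y z : α) : threeCycle x y z z = x := by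
  simp [threeCycle]

theorem threeCycle_apply_of_ne {x y z w : α} (hx : w ≠ x) (hy : w ≠ y) (hz : w ≠ z) :
    threeCycle x y z w = w := by
  simp [threeCycle, swap_apply_of_ne_of_ne, *]

theorem threeCycle_inv {x y z : α} (hxy : x ≠ y) (hyz : y ≠ z) (hxz : x ≠ z) :
    (threeCycle x y z)⁻¹ = threeCycle x z y := by
  rw [inv_eq_iff_mul_eq_one]
  ext w
  rw [mul_apply, one_apply]
  by_cases h1 : w = x
  · rw [h1, threeCycle_apply_fst hxz hxy, threeCycle_apply_trd]
  by_cases h2 : w = y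
  · rw [h2, threeCycle_apply_trd, threeCycle_apply_fst hxy hxz]
  by_cases h3 : w = z
  · rw [h3, threeCycle_apply_snd hyz.symm hxy, threeCycle_apply_snd hyz hxz]
  rw [threeCycle_apply_of_ne h1 h3 h2, threeCycle_apply_of_ne h1 h2 h3]

variable [Fintype α]

theorem card_parts_partition_eq_card_of_transversal (σ : Perm α) (M : Finset α)
    (hM : ∀ x, ∃ u ∈ M, σ.SameCycle u x)
    (hM' : ∀ u ∈ M, ∀ v ∈ M, σ.SameCycle u v → u = v) :
    σ.partition.parts.card = M.card := by
  have h1 : (M.filter (· ∈ σ.support)).card = σ.cycleFactorsFinset.card := by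
    refine Finset.card_nbij σ.cycleOf ?_ ?_ ?_
    · intro u hu
      have hu := (mem_filter.1 (mem_coe.1 hu)).2
      exact mem_coe.2 (cycleOf_mem_cycleFactorsFinset_iff.2 hu)
    · intro u hu v hv huv
      have hu := mem_filter.1 (mem_coe.1 hu)
      have hv := mem_filter.1 (mem_coe.1 hv)
      exact hM' u hu.1 v hv.1
        ((sameCycle_iff_cycleOf_eq_of_mem_support hu.2 hv.2).2 huv)
    · intro c hc
      have hc' := mem_cycleFactorsFinset_iff.1 (mem_coe.1 hc)
      obtain ⟨x, hx⟩ := IsCycle.nonempty_support hc'.1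
      have hcx : c = σ.cycleOf x := cycle_is_cycleOf hx (mem_coe.1 hc)
      obtain ⟨u, huM, hu⟩ := hM x
      have hxs : x ∈ σ.support := mem_cycleFactorsFinset_support_le (mem_coe.1 hc) hx
      have hus : u ∈ σ.support := by
        rw [mem_support] at hxs ⊢
        exact fun h => hxs (hu.apply_eq_self_iff.1 h)
      exact ⟨u, mem_coe.2 (mem_filter.2 ⟨huM, hus⟩), by rw [hcx, hu.cycleOf_eq]⟩
  have h2 : M.filter (· ∉ σ.support) = σ.supportᶜ := by
    ext x
    simp only [mem_filter, mem_compl, and_iff_right_iff_imp]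
    intro hx
    obtain ⟨u, huM, hu⟩ := hM x
    have hx' : σ x = x := notMem_support.1 hx
    have : u = x := (hu.symm.eq_of_left hx').symm
    exact this ▸ huM
  have h3 := card_filter_add_card_filter_not (s := M) (fun x => x ∈ σ.support)
  rw [h2, h1, card_compl] at h3
  simp [parts_partition, cycleType_def, ← h3]

/-- If `x` is the only point of its `σ`-cycle that `c` may move, and `c y = x`, then from `y` the
permutation `σ * c` runs once through the `σ`-cycle of `x`, starting at `σ x` and ending
at `x`. -/
theorem exists_pow_mul_apply_eq {σ c : Perm α} {x y z : α}
    (hc : ∀ w, σ.SameCycle x w → w ≠ x → c w = w) (hy : c y = x) (hz : σ.SameCycle x z) :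
    ∃ i, 0 < i ∧ ((σ * c) ^ i) y = z ∧
      ∀ j, 0 < j → j < i → σ.SameCycle x (((σ * c) ^ j) y) ∧ ((σ * c) ^ j) y ≠ x := by
  classical
  have hex : ∃ i, 0 < i ∧ (σ ^ i) x = z := by
    obtain ⟨i, h0, -, hi⟩ := hz.exists_pow_eq''
    exact ⟨i, h0, hi⟩
  set i := Nat.find hex with hidef
  obtain ⟨h0, hi⟩ := Nat.find_spec hex
  rw [← hidef] at h0 hi
  have hne : ∀ j, 0 < j → j < i → (σ ^ j) x ≠ x := by
    intro j hj hji hjx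
    refine Nat.find_min hex (m := i - j) (by omega) ⟨by omega, ?_⟩
    have : (σ ^ (i - j)) ((σ ^ j) x) = z := by
      rw [← mul_apply, ← pow_add, Nat.sub_add_cancel hji.le, hi]
    rwa [hjx] at this
  have key : ∀ j, 0 < j → j ≤ i → ((σ * c) ^ j) y = (σ ^ j) x := by
    intro j hj
    induction j, hj using Nat.le_induction with
    | base => intro _; simp [hy]
    | succ j hj ih =>
      intro hji
      rw [pow_succ', mul_apply, ih (by omega), pow_succ', mul_apply, mul_apply,
        hc _ ⟨j, by simp⟩ (hne j hj (by omega))]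
  refine ⟨i, h0, by rw [key i h0 le_rfl, hi], fun j hj hji => ?_⟩
  rw [key j hj hji.le]
  exact ⟨⟨j, by simp⟩, hne j hj hji⟩

section Merge

variable {σ : Perm α} {x y z : α} (hxy : ¬ σ.SameCycle x y) (hyz : ¬ σ.SameCycle y z)
  (hxz : ¬ σ.SameCycle x z)
include hxy hyz hxz

/-- Multiplication by a three-cycle whose points lie on different cycles of `σ` merges
these three cycles and leaves all others as they are. -/
theorem sameCycle_mul_threeCycle_iff {u v : α} :
    (σ * threeCycle x y z).SameCycle u v ↔ σ.SameCycle u v ∨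
      ((σ.SameCycle x u ∨ σ.SameCycle y u ∨ σ.SameCycle z u) ∧
        (σ.SameCycle x v ∨ σ.SameCycle y v ∨ σ.SameCycle z v)) := by
  have nxy : x ≠ y := fun h => hxy (h ▸ SameCycle.refl _ _)
  have nyz : y ≠ z := fun h => hyz (h ▸ SameCycle.refl _ _)
  have nxz : x ≠ z := fun h => hxz (h ▸ SameCycle.refl _ _)
  set c := threeCycle x y z with hc
  have cx : c x = y := threeCycle_apply_fst nxy nxz
  have cy : c y = z := threeCycle_apply_snd nyz nxz
  have cz : c z = x := threeCycle_apply_trd x y z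
  have cne : ∀ w, w ≠ x → w ≠ y → w ≠ z → c w = w := fun w => threeCycle_apply_of_ne
  have hcx : ∀ w, σ.SameCycle x w → w ≠ x → c w = w := by
    rintro w hw hwx
    refine cne w hwx ?_ ?_ <;> rintro rfl <;> contradiction
  have hcy : ∀ w, σ.SameCycle y w → w ≠ y → c w = w := by
    rintro w hw hwx
    refine cne w ?_ hwx ?_
    · rintro rfl; exact hxy hw.symm
    · rintro rfl; exact hyz hw
  have hcz : ∀ w, σ.SameCycle z w → w ≠ z → c w = w := by
    rintro w hw hwx
    refine cne w ?_ ?_ hwx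
    · rintro rfl; exact hxz hw.symm
    · rintro rfl; exact hyz hw.symm
  have reach : ∀ {p q r : α}, (∀ w, σ.SameCycle p w → w ≠ p → c w = w) → c q = p →
      σ.SameCycle p r → (σ * c).SameCycle q r := by
    intro p q r h1 h2 h3
    obtain ⟨i, -, hi, -⟩ := exists_pow_mul_apply_eq h1 h2 h3
    exact ⟨i, by simpa using hi⟩
  constructor
  · rintro h
    obtain ⟨m, -, rfl⟩ := h.exists_pow_eq'
    clear h
    induction m with
    | zero => exact Or.inl (SameCycle.refl _ _)
    | succ m ih =>
      set w := ((σ * c) ^ m) u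
      have hw : ((σ * c) ^ (m + 1)) u = σ (c w) := by
        rw [pow_succ', mul_apply, mul_apply]
      rw [hw]
      simp only [sameCycle_apply_right]
      by_cases h1 : w = x
      · rw [h1, cx]; rw [h1] at ih
        rcases ih with ih | ih
        · exact Or.inr ⟨Or.inl ih.symm, Or.inr (Or.inl (SameCycle.refl _ _))⟩
        · exact Or.inr ⟨ih.1, Or.inr (Or.inl (SameCycle.refl _ _))⟩
      by_cases h2 : w = y
      · rw [h2, cy]; rw [h2] at ih
        rcases ih with ih | ih
        · exact Or.inr ⟨Or.inr (Or.inl ih.symm), Or.inr (Or.inr (SameCycle.refl _ _))⟩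
        · exact Or.inr ⟨ih.1, Or.inr (Or.inr (SameCycle.refl _ _))⟩
      by_cases h3 : w = z
      · rw [h3, cz]; rw [h3] at ih
        rcases ih with ih | ih
        · exact Or.inr ⟨Or.inr (Or.inr ih.symm), Or.inl (SameCycle.refl _ _)⟩
        · exact Or.inr ⟨ih.1, Or.inl (SameCycle.refl _ _)⟩
      rw [cne w h1 h2 h3]
      exact ih
  · have xy : (σ * c).SameCycle x y := reach hcy cx (SameCycle.refl _ _)
    have yz : (σ * c).SameCycle y z := reach hcz cy (SameCycle.refl _ _)
    have step : ∀ w, (σ * c).SameCycle w (σ w) := by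
      intro w
      by_cases h1 : w = x
      · rw [h1]
        exact (reach hcx cz (SameCycle.refl _ _)).symm.trans
          (reach hcx cz (by simp [SameCycle.refl]))
      by_cases h2 : w = y
      · rw [h2]
        exact (reach hcy cx (SameCycle.refl _ _)).symm.trans
          (reach hcy cx (by simp [SameCycle.refl]))
      by_cases h3 : w = z
      · rw [h3]
        exact (reach hcz cy (SameCycle.refl _ _)).symm.trans
          (reach hcz cy (by simp [SameCycle.refl]))
      exact ⟨1, by simp [cne w h1 h2 h3]⟩
    have mono : ∀ {p q : α}, σ.SameCycle p q → (σ * c).SameCycle p q := by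
      intro p q h
      obtain ⟨m, -, rfl⟩ := h.exists_pow_eq'
      clear h
      induction m with
      | zero => exact SameCycle.refl _ _
      | succ m ih => rw [pow_succ', mul_apply]; exact ih.trans (step _)
    have all : ∀ {w : α}, (σ.SameCycle x w ∨ σ.SameCycle y w ∨ σ.SameCycle z w) →
        (σ * c).SameCycle x w := by
      rintro w (h | h | h)
      · exact mono h
      · exact xy.trans (mono h)
      · exact xy.trans (yz.trans (mono h))
    rintro (h | ⟨h, h'⟩)
    · exact mono h
    · exact (all h).symm.trans (all h')

theorem card_parts_partition_mul_threeCycle (M : Finset α)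
    (hM : ∀ x, ∃ u ∈ M, σ.SameCycle u x)
    (hM' : ∀ u ∈ M, ∀ v ∈ M, σ.SameCycle u v → u = v) :
    (σ * threeCycle x y z).partition.parts.card + 2 = σ.partition.parts.card := by
  have iff := @sameCycle_mul_threeCycle_iff _ _ _ σ x y z hxy hyz hxz
  obtain ⟨rx, hrx, hx⟩ := hM x
  obtain ⟨ry, hry, hy⟩ := hM y
  obtain ⟨rz, hrz, hz⟩ := hM z
  have nyz : rz ≠ ry := fun h => hyz (hy.symm.trans (h ▸ hz))
  have nxy : rx ≠ ry := fun h => hxy (hx.symm.trans (h ▸ hy))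
  have nxz : rx ≠ rz := fun h => hxz (hx.symm.trans (h ▸ hz))
  rw [card_parts_partition_eq_card_of_transversal σ M hM hM',
    card_parts_partition_eq_card_of_transversal _ ((M.erase ry).erase rz)]
  · rw [card_erase_of_mem (mem_erase.2 ⟨nyz, hrz⟩), card_erase_of_mem hry]
    have : ({rz, ry} : Finset α).card ≤ M.card := card_le_card (by
      intro w hw
      simp only [mem_insert, mem_singleton] at hw
      rcases hw with rfl | rfl <;> assumption)
    rw [card_pair nyz] at this
    omega
  · intro w
    obtain ⟨u, hu, huw⟩ := hM w
    by_cases hw : σ.SameCycle x w ∨ σ.SameCycle y w ∨ σ.SameCycle z w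
    · exact ⟨rx, by simp [hrx, nxy, nxz], iff.2 (Or.inr ⟨Or.inl hx.symm, hw⟩)⟩
    · refine ⟨u, ?_, iff.2 (Or.inl huw)⟩
      simp only [mem_erase]
      refine ⟨?_, ?_, hu⟩
      · rintro rfl; exact hw (Or.inr (Or.inr (hz.symm.trans huw)))
      · rintro rfl; exact hw (Or.inr (Or.inl (hy.symm.trans huw)))
  · have rep : ∀ u ∈ (M.erase ry).erase rz,
        (σ.SameCycle x u ∨ σ.SameCycle y u ∨ σ.SameCycle z u) → u = rx := by
      intro u hu h
      simp only [mem_erase] at hu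
      rcases h with h | h | h
      · exact hM' u hu.2.2 rx hrx (hx.trans h).symm
      · exact absurd (hM' u hu.2.2 ry hry (hy.trans h).symm) hu.2.1
      · exact absurd (hM' u hu.2.2 rz hrz (hz.trans h).symm) hu.1
    intro u hu v hv huv
    rcases iff.1 huv with h | ⟨h, h'⟩
    · simp only [mem_erase] at hu hv
      exact hM' u hu.2.2 v hv.2.2 h
    · rw [rep u hu h, rep v hv h']

end Merge

end Equiv.Perm

/-! ### Positions and block transpositions -/

/-- The relabelling of positions that exchanges the adjacent blocks `(i, j]` and `(j, l]`. -/
def blockSwap (i j l m : ℕ) : ℕ :=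
  if m ≤ i then m else if m ≤ j then m + (l - j) else if m ≤ l then m - (j - i) else m

theorem blockSwap_injective {i j l : ℕ} (hij : i < j) (hjl : j < l) :
    Function.Injective (blockSwap i j l) := by
  intro a b h
  unfold blockSwap at h
  split_ifs at h <;> omega

theorem blockSwap_lt {i j l m n : ℕ} (hij : i < j) (hjl : j < l) (hl : l < n) (hm : m < n) :
    blockSwap i j l m < n := by
  unfold blockSwap
  split_ifs <;> omega

namespace PlanePermutation

open Equiv.Perm

variable {n : ℕ}

theorem position_lt (p : PlanePermutation n) (b x : Fin n) : p.position b x < n := by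
  have h : p.s.IsCycleOn (Finset.univ : Finset (Fin n)) := by simpa using p.isCycleOn
  obtain ⟨m, hm, hx⟩ := h.exists_pow_eq (Finset.mem_univ b) (Finset.mem_univ x)
  rw [Finset.card_univ, Fintype.card_fin] at hm
  exact (Nat.sInf_le hx).trans_lt hm

theorem position_injective (p : PlanePermutation n) (b : Fin n) :
    Function.Injective (p.position b) := by
  intro x y h
  rw [← p.pow_position b x, ← p.pow_position b y, h]

theorem position_eq_of_pow_apply (p : PlanePermutation n) {b x : Fin n} {m : ℕ} (hm : m < n)
    (h : (p.s ^ m) b = x) : p.position b x = m := by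
  have hc : p.s.IsCycleOn (Finset.univ : Finset (Fin n)) := by simpa using p.isCycleOn
  have h1 : (p.s ^ p.position b x) b = (p.s ^ m) b := by rw [p.pow_position, h]
  have h2 := (hc.pow_apply_eq_pow_apply (Finset.mem_univ b)).1 h1
  rw [Finset.card_univ, Fintype.card_fin] at h2
  exact h2.eq_of_lt_of_lt (p.position_lt b x) hm

theorem position_self (p : PlanePermutation n) (b : Fin n) : p.position b b = 0 :=
  p.position_eq_of_pow_apply (Nat.zero_le _ |>.trans_lt b.2) (by simp)

theorem position_s_apply (p : PlanePermutation n) {b x : Fin n} (h : p.position b x + 1 < n) :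
    p.position b (p.s x) = p.position b x + 1 :=
  p.position_eq_of_pow_apply h (by rw [pow_succ', mul_apply, p.pow_position])

/-- An injective numbering `f` by `0, …, n - 1` in which `s` raises the number by one is the
position in `s`. -/
theorem pow_apply_of_position {s : Equiv.Perm (Fin n)} {b : Fin n} {f : Fin n → ℕ}
    (hinj : Function.Injective f) (hlt : ∀ x, f x < n) (hb : f b = 0)
    (hs : ∀ x, f x + 1 < n → f (s x) = f x + 1) (x : Fin n) : (s ^ f x) b = x := by
  have key : ∀ m, m < n → f ((s ^ m) b) = m := by
    intro m
    induction m with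
    | zero => intro _; simpa using hb
    | succ m ih =>
      intro hm
      have := ih (by omega)
      rw [pow_succ', mul_apply, hs _ (by omega), this]
  exact hinj (key _ (hlt x))

theorem isCycleOn_of_position {s : Equiv.Perm (Fin n)} {b : Fin n} {f : Fin n → ℕ}
    (hinj : Function.Injective f) (hlt : ∀ x, f x < n) (hb : f b = 0)
    (hs : ∀ x, f x + 1 < n → f (s x) = f x + 1) : s.IsCycleOn Set.univ := by
  refine ⟨by simp, fun x _ y _ => ?_⟩
  have h : ∀ z, s.SameCycle b z := fun z =>
    ⟨f z, by simpa using pow_apply_of_position hinj hlt hb hs z⟩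
  exact (h x).symm.trans (h y)

section BlockTranspose

variable (p : PlanePermutation n) (b x y z : Fin n)

theorem blockSwap_position_injective (hxy : p.position b x < p.position b y)
    (hyz : p.position b y < p.position b z) :
    Function.Injective fun w =>
      blockSwap (p.position b x) (p.position b y) (p.position b z) (p.position b w) :=
  (blockSwap_injective hxy hyz).comp (p.position_injective b)

/-- In the numbering of positions with two blocks exchanged, `s` times the three-cycle moves every
element but the last to the next position. -/
theorem blockSwap_position_s_mul_threeCycle (hxy : p.position b x < p.position b y)
    (hyz : p.position b y < p.position b z) (w : Fin n)
    (hw : blockSwap (p.position b x) (p.position b y) (p.position b z) (p.position b w) + 1 < n) :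
    blockSwap (p.position b x) (p.position b y) (p.position b z)
        (p.position b ((p.s * threeCycle x y z) w)) =
      blockSwap (p.position b x) (p.position b y) (p.position b z) (p.position b w) + 1 := by
  have nxy : x ≠ y := by rintro rfl; exact lt_irrefl _ hxy
  have nyz : y ≠ z := by rintro rfl; exact lt_irrefl _ hyz
  have nxz : x ≠ z := by rintro rfl; exact lt_asymm hxy hyz
  have hz := p.position_lt b z
  have hw' := p.position_lt b w
  rw [mul_apply]
  by_cases h1 : w = x
  · subst h1
    rw [threeCycle_apply_fst nxy nxz, p.position_s_apply (by omega)]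
    unfold blockSwap
    split_ifs <;> omega
  by_cases h2 : w = y
  · subst h2
    rw [threeCycle_apply_snd nyz nxz]
    rw [p.position_s_apply (by revert hw; unfold blockSwap; split_ifs <;> omega)]
    unfold blockSwap
    split_ifs <;> omega
  by_cases h3 : w = z
  · subst h3
    rw [threeCycle_apply_trd, p.position_s_apply (by omega)]
    unfold blockSwap
    split_ifs <;> omega
  rw [threeCycle_apply_of_ne h1 h2 h3]
  have n1 : p.position b w ≠ p.position b x := fun h => h1 (p.position_injective b h)
  have n2 : p.position b w ≠ p.position b y := fun h => h2 (p.position_injective b h)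
  have n3 : p.position b w ≠ p.position b z := fun h => h3 (p.position_injective b h)
  rw [p.position_s_apply (by revert hw; unfold blockSwap; split_ifs <;> omega)]
  unfold blockSwap
  split_ifs <;> omega

/-- For `x <_s y <_s z`, the plane permutation with the same diagonal in which the two adjacent
blocks of `s` that end at `y` and `z`, the first of them starting right after `x`, are exchanged.
Both `s` and `π` get multiplied by the three-cycle `x ↦ y ↦ z ↦ x`. -/
def blockTranspose (hxy : p.position b x < p.position b y)
    (hyz : p.position b y < p.position b z) : PlanePermutation n where
  s := p.s * threeCycle x y z
  π := p.π * threeCycle x y z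
  isCycleOn := isCycleOn_of_position (b := b) (p.blockSwap_position_injective b x y z hxy hyz)
    (fun w => blockSwap_lt hxy hyz (p.position_lt b z) (p.position_lt b w))
    (by simp [blockSwap, position_self])
    (p.blockSwap_position_s_mul_threeCycle b x y z hxy hyz)

variable {x y z} (hxy : p.position b x < p.position b y) (hyz : p.position b y < p.position b z)

theorem position_blockTranspose (w : Fin n) :
    (p.blockTranspose b x y z hxy hyz).position b w =
      blockSwap (p.position b x) (p.position b y) (p.position b z) (p.position b w) :=
  position_eq_of_pow_apply _ (blockSwap_lt hxy hyz (p.position_lt b z) (p.position_lt b w))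
    (pow_apply_of_position (p.blockSwap_position_injective b x y z hxy hyz)
      (fun w => blockSwap_lt hxy hyz (p.position_lt b z) (p.position_lt b w))
      (by simp [blockSwap, position_self])
      (p.blockSwap_position_s_mul_threeCycle b x y z hxy hyz) w)

theorem diagonal_blockTranspose :
    (p.blockTranspose b x y z hxy hyz).diagonal = p.diagonal := by
  simp [diagonal, blockTranspose, mul_assoc]

theorem position_blockTranspose_fst_lt_trd :
    (p.blockTranspose b x y z hxy hyz).position b x <
      (p.blockTranspose b x y z hxy hyz).position b z := by
  simp only [position_blockTranspose, blockSwap]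
  split_ifs <;> omega

theorem position_blockTranspose_trd_lt_snd :
    (p.blockTranspose b x y z hxy hyz).position b z <
      (p.blockTranspose b x y z hxy hyz).position b y := by
  simp only [position_blockTranspose, blockSwap]
  split_ifs <;> omega

/-- Exchanging the two blocks a second time restores the plane permutation. -/
theorem blockTranspose_blockTranspose :
    (p.blockTranspose b x y z hxy hyz).blockTranspose b x z y
      (p.position_blockTranspose_fst_lt_trd b hxy hyz)
      (p.position_blockTranspose_trd_lt_snd b hxy hyz) = p := by
  have nxy : x ≠ y := by rintro rfl; exact lt_irrefl _ hxy
  have nyz : y ≠ z := by rintro rfl; exact lt_irrefl _ hyz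
  have nxz : x ≠ z := by rintro rfl; exact lt_asymm hxy hyz
  apply PlanePermutation.ext <;>
    simp [blockTranspose, ← threeCycle_inv nxy nyz nxz, mul_assoc]

end BlockTranspose

end PlanePermutation

/-! ### Gluing three cycles and slicing a cycle into three -/

namespace Equiv.Perm

/-- If `c` leads from the end of an arc of a `σ`-cycle back to the point before the arc and fixes
the interior of the arc, then the arc is a union of cycles of `σ * c`. -/
theorem exists_pow_eq_of_sameCycle_mul {α : Type*} [Finite α] {σ c : Perm α} {x w : α} {lo hi : ℕ}
    (hlt : lo < hi) (hend : c ((σ ^ hi) x) = (σ ^ lo) x)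
    (hmid : ∀ i, lo < i → i < hi → c ((σ ^ i) x) = (σ ^ i) x)
    (h : (σ * c).SameCycle ((σ ^ hi) x) w) : ∃ i, lo < i ∧ i ≤ hi ∧ (σ ^ i) x = w := by
  obtain ⟨m, -, rfl⟩ := h.exists_pow_eq'
  clear h
  induction m with
  | zero => exact ⟨hi, hlt, le_rfl, by simp⟩
  | succ m ih =>
    obtain ⟨i, h1, h2, h3⟩ := ih
    rw [pow_succ', mul_apply, mul_apply, ← h3]
    rcases h2.eq_or_lt with rfl | h2
    · exact ⟨lo + 1, by omega, by omega, by rw [hend, pow_succ', mul_apply]⟩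
    · exact ⟨i + 1, by omega, by omega, by rw [hmid i h1 h2, pow_succ', mul_apply]⟩

end Equiv.Perm

namespace PlanePermutation

open Equiv.Perm

variable {n : ℕ}

/-- `u` is the `<_s`-least element of its cycle, for `s` written with leftmost element `b`. -/
def IsCycleMin (p : PlanePermutation n) (b u : Fin n) : Prop :=
  ∀ w, p.π.SameCycle u w → p.position b u ≤ p.position b w

open Classical in
/-- The least elements `u` of cycles of `p` such that `u` lies before all elements of the cycle
of `v`. -/
noncomputable def minsBelow (p : PlanePermutation n) (b v : Fin n) : Finset (Fin n) :=
  Finset.univ.filter fun u =>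
    p.IsCycleMin b u ∧ ∀ w, p.π.SameCycle v w → p.position b u < p.position b w

/-- `v` is the image under `π` of an element that is not an exceedance. -/
def IsAntiExcValue (p : PlanePermutation n) (b v : Fin n) : Prop :=
  p.position b v ≤ p.position b (p.π⁻¹ v)

theorem mem_minsBelow {p : PlanePermutation n} {b u v : Fin n} :
    u ∈ p.minsBelow b v ↔
      p.IsCycleMin b u ∧ ∀ w, p.π.SameCycle v w → p.position b u < p.position b w := by
  simp [minsBelow]

theorem IsCycleMin.isAntiExcValue {p : PlanePermutation n} {b u : Fin n}
    (h : p.IsCycleMin b u) : p.IsAntiExcValue b u :=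
  h _ (SameCycle.symm ⟨1, by simp⟩)

theorem exists_isCycleMin (p : PlanePermutation n) (b v : Fin n) :
    ∃ u, p.IsCycleMin b u ∧ p.π.SameCycle u v := by
  classical
  obtain ⟨u, hu, hmin⟩ := Finset.exists_min_image
    (Finset.univ.filter fun u => p.π.SameCycle u v) (p.position b)
    ⟨v, by simp [SameCycle.refl]⟩
  simp only [Finset.mem_filter, Finset.mem_univ, true_and] at hu hmin
  exact ⟨u, fun w hw => hmin w (hw.symm.trans hu), hu⟩

theorem IsCycleMin.eq_of_sameCycle {p : PlanePermutation n} {b u v : Fin n}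
    (hu : p.IsCycleMin b u) (hv : p.IsCycleMin b v) (h : p.π.SameCycle u v) : u = v :=
  p.position_injective b (le_antisymm (hu v h) (hv u h.symm))

open Classical in
theorem numCycles_eq_card (p : PlanePermutation n) (b : Fin n) :
    p.numCycles = (Finset.univ.filter fun u => p.IsCycleMin b u).card := by
  refine card_parts_partition_eq_card_of_transversal p.π _ (fun x => ?_) fun u hu v hv h => ?_
  · obtain ⟨u, hu, hux⟩ := p.exists_isCycleMin b x
    exact ⟨u, by simpa using hu, hux⟩
  · simp only [Finset.mem_filter, Finset.mem_univ, true_and] at hu hv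
    exact hu.eq_of_sameCycle hv h

section Glue

variable {q : PlanePermutation n} {b v x y : Fin n}

theorem not_sameCycle_of_mem_minsBelow {u : Fin n} (h : u ∈ q.minsBelow b v) :
    ¬ q.π.SameCycle u v := fun h' => lt_irrefl _ ((mem_minsBelow.1 h).2 u h'.symm)

theorem position_lt_of_mem_minsBelow {u : Fin n} (h : u ∈ q.minsBelow b v) :
    q.position b u < q.position b v := (mem_minsBelow.1 h).2 v (SameCycle.refl _ _)

theorem mem_minsBelow_trans (hy : y ∈ q.minsBelow b v) (hx : x ∈ q.minsBelow b y) :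
    x ∈ q.minsBelow b v :=
  mem_minsBelow.2 ⟨(mem_minsBelow.1 hx).1, fun w hw =>
    (position_lt_of_mem_minsBelow hx).trans ((mem_minsBelow.1 hy).2 w hw)⟩

variable (hy : y ∈ q.minsBelow b v) (hx : x ∈ q.minsBelow b y)
include hy hx

/-- Gluing, that is, block transposition at `x`, `y`, `v`, where `x` and `y` are the least elements
of two cycles and `v` is on a third cycle above them, merges these three cycles of `π`. -/
theorem sameCycle_glue_iff {u w : Fin n} :
    (q.blockTranspose b x y v (position_lt_of_mem_minsBelow hx)
      (position_lt_of_mem_minsBelow hy)).π.SameCycle u w ↔ q.π.SameCycle u w ∨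
      ((q.π.SameCycle x u ∨ q.π.SameCycle y u ∨ q.π.SameCycle v u) ∧
        (q.π.SameCycle x w ∨ q.π.SameCycle y w ∨ q.π.SameCycle v w)) :=
  sameCycle_mul_threeCycle_iff (not_sameCycle_of_mem_minsBelow hx)
    (not_sameCycle_of_mem_minsBelow hy)
    (not_sameCycle_of_mem_minsBelow (mem_minsBelow_trans hy hx))

theorem numCycles_glue :
    (q.blockTranspose b x y v (position_lt_of_mem_minsBelow hx)
      (position_lt_of_mem_minsBelow hy)).numCycles + 2 = q.numCycles := by
  classical
  refine card_parts_partition_mul_threeCycle (not_sameCycle_of_mem_minsBelow hx)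
    (not_sameCycle_of_mem_minsBelow hy)
    (not_sameCycle_of_mem_minsBelow (mem_minsBelow_trans hy hx))
    (Finset.univ.filter fun u => q.IsCycleMin b u) (fun w => ?_) fun u hu w hw h => ?_
  · obtain ⟨u, hu, hux⟩ := q.exists_isCycleMin b w
    exact ⟨u, by simpa using hu, hux⟩
  · simp only [Finset.mem_filter, Finset.mem_univ, true_and] at hu hw
    exact hu.eq_of_sameCycle hw h

theorem position_le_of_sameCycle_glued {w : Fin n}
    (hw : q.π.SameCycle x w ∨ q.π.SameCycle y w ∨ q.π.SameCycle v w) :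
    q.position b x ≤ q.position b w := by
  rcases hw with hw | hw | hw
  · exact (mem_minsBelow.1 hx).1 w hw
  · exact ((mem_minsBelow.1 hx).2 w hw).le
  · exact ((mem_minsBelow.1 (mem_minsBelow_trans hy hx)).2 w hw).le

theorem sameCycle_glue_fst_trd :
    (q.blockTranspose b x y v (position_lt_of_mem_minsBelow hx)
      (position_lt_of_mem_minsBelow hy)).π.SameCycle x v :=
  (sameCycle_glue_iff hy hx).2 (Or.inr ⟨Or.inl (SameCycle.refl _ _),
    Or.inr (Or.inr (SameCycle.refl _ _))⟩)

theorem isCycleMin_glue :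
    (q.blockTranspose b x y v (position_lt_of_mem_minsBelow hx)
      (position_lt_of_mem_minsBelow hy)).IsCycleMin b x := by
  intro w hw
  have hxw : q.position b x ≤ q.position b w := by
    rcases (sameCycle_glue_iff hy hx).1 hw with h | ⟨-, h⟩
    · exact position_le_of_sameCycle_glued hy hx (Or.inl h)
    · exact position_le_of_sameCycle_glued hy hx h
  have h1 := position_lt_of_mem_minsBelow hx
  have h2 := position_lt_of_mem_minsBelow hy
  simp only [position_blockTranspose, blockSwap]
  split_ifs <;> omega

theorem not_isCycleMin_glue :
    ¬ (q.blockTranspose b x y v (position_lt_of_mem_minsBelow hx)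
      (position_lt_of_mem_minsBelow hy)).IsCycleMin b v := by
  intro h
  have := h x (sameCycle_glue_fst_trd hy hx).symm
  exact absurd (q.position_blockTranspose_fst_lt_trd b (position_lt_of_mem_minsBelow hx)
    (position_lt_of_mem_minsBelow hy)) (not_lt.2 this)

theorem isAntiExcValue_glue (hv : q.IsAntiExcValue b v) :
    (q.blockTranspose b x y v (position_lt_of_mem_minsBelow hx)
      (position_lt_of_mem_minsBelow hy)).IsAntiExcValue b v := by
  have h1 := position_lt_of_mem_minsBelow hx
  have h2 := position_lt_of_mem_minsBelow hy
  have nxy : x ≠ y := by rintro rfl; exact lt_irrefl _ h1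
  have nyv : y ≠ v := by rintro rfl; exact lt_irrefl _ h2
  have nxv : x ≠ v := by rintro rfl; exact lt_asymm h1 h2
  unfold IsAntiExcValue at *
  have hinv : (q.blockTranspose b x y v h1 h2).π⁻¹ v = threeCycle x v y (q.π⁻¹ v) := by
    simp only [blockTranspose, mul_inv_rev, threeCycle_inv nxy nyv nxv, mul_apply]
  have hsame : q.π.SameCycle v (q.π⁻¹ v) := SameCycle.symm ⟨1, by simp⟩
  rw [hinv]
  by_cases hf : q.π⁻¹ v = v
  · rw [hf, threeCycle_apply_snd nyv.symm nxy]
    exact (q.position_blockTranspose_trd_lt_snd b h1 h2).le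
  · have hne : q.position b (q.π⁻¹ v) ≠ q.position b v := fun h => hf (q.position_injective b h)
    rw [threeCycle_apply_of_ne _ hf]
    · simp only [position_blockTranspose, blockSwap]
      split_ifs <;> omega
    · intro h
      exact not_sameCycle_of_mem_minsBelow hy (h ▸ hsame).symm
    · intro h
      exact not_sameCycle_of_mem_minsBelow (mem_minsBelow_trans hy hx) (h ▸ hsame).symm

/-- Gluing does not affect the part of `s` up to `x`, nor the cycles with least element
before `x`. -/
theorem minsBelow_glue :
    (q.blockTranspose b x y v (position_lt_of_mem_minsBelow hx)
      (position_lt_of_mem_minsBelow hy)).minsBelow b v = q.minsBelow b x := by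
  have h1 := position_lt_of_mem_minsBelow hx
  have h2 := position_lt_of_mem_minsBelow hy
  have hpos : ∀ u w, q.position b u < q.position b x →
      ((q.blockTranspose b x y v h1 h2).position b u ≤
        (q.blockTranspose b x y v h1 h2).position b w ↔ q.position b u ≤ q.position b w) := by
    intro u w hu
    simp only [position_blockTranspose, blockSwap]
    split_ifs <;> omega
  have hposx : ∀ u, (q.blockTranspose b x y v h1 h2).position b u <
        (q.blockTranspose b x y v h1 h2).position b x ↔ q.position b u < q.position b x := by
    intro u
    simp only [position_blockTranspose, blockSwap]
    split_ifs <;> omega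
  have hcyc : ∀ u w, q.position b u < q.position b x → q.IsCycleMin b u →
      ((q.blockTranspose b x y v h1 h2).π.SameCycle u w ↔ q.π.SameCycle u w) := by
    intro u w hu hmin
    rw [sameCycle_glue_iff hy hx]
    refine or_iff_left fun h => ?_
    exact absurd hu (not_lt.2 (position_le_of_sameCycle_glued hy hx h.1))
  ext u
  rw [mem_minsBelow, mem_minsBelow]
  constructor
  · rintro ⟨hmin, hlt⟩
    have hux := (hposx u).1 (hlt x (sameCycle_glue_fst_trd hy hx).symm)
    refine ⟨fun w hw => (hpos u w hux).1 (hmin w ((sameCycle_glue_iff hy hx).2 (Or.inl hw))),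
      fun w hw => hux.trans_le ((mem_minsBelow.1 hx).1 w hw)⟩
  · rintro ⟨hmin, hlt⟩
    have hux := hlt x (SameCycle.refl _ _)
    refine ⟨fun w hw => (hpos u w hux).2 (hmin w ((hcyc u w hux hmin).1 hw)), fun w hw => ?_⟩
    exact ((hposx u).2 hux).trans_le
      (isCycleMin_glue hy hx w ((sameCycle_glue_fst_trd hy hx).trans hw))

end Glue

/-- Two gluings at `x`, `y`, `v` and at `x`, `y'`, `v` with the same result `p` do not have
`y <_s y'` in `p`: otherwise `y` would have to lie on the arc of `π` from `x` to `v`, because of the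
first gluing, and on the arc from `v` to `x`, because of the second. -/
theorem not_position_lt_of_glue_eq {p q r : PlanePermutation n} {b v x y y' : Fin n}
    (hy : y ∈ q.minsBelow b v) (hx : x ∈ q.minsBelow b y)
    (hy' : y' ∈ r.minsBelow b v) (hx' : x ∈ r.minsBelow b y')
    (hq : q.blockTranspose b x y v (position_lt_of_mem_minsBelow hx)
      (position_lt_of_mem_minsBelow hy) = p)
    (hr : r.blockTranspose b x y' v (position_lt_of_mem_minsBelow hx')
      (position_lt_of_mem_minsBelow hy') = p) : ¬ p.position b y < p.position b y' := by
  intro hlt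
  have h1 := position_lt_of_mem_minsBelow hx
  have h2 := position_lt_of_mem_minsBelow hy
  have h1' := position_lt_of_mem_minsBelow hx'
  have h2' := position_lt_of_mem_minsBelow hy'
  have nxy : x ≠ y := by rintro rfl; exact lt_irrefl _ h1
  have nyv : y ≠ v := by rintro rfl; exact lt_irrefl _ h2
  have nxv : x ≠ v := by rintro rfl; exact lt_asymm h1 h2
  have nxy' : x ≠ y' := by rintro rfl; exact lt_irrefl _ h1'
  have nyv' : y' ≠ v := by rintro rfl; exact lt_irrefl _ h2'
  have hvy : p.position b v < p.position b y := by
    rw [← hq]; exact q.position_blockTranspose_trd_lt_snd b h1 h2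
  have hry : r.position b y < r.position b y' := by
    rw [← hr] at hlt hvy
    simp only [position_blockTranspose, blockSwap] at hlt hvy
    revert hlt hvy
    split_ifs <;> omega
  have hpy : p.π.SameCycle x y := by
    rw [← hq]
    exact (sameCycle_glue_iff hy hx).2 (Or.inr ⟨Or.inl (SameCycle.refl _ _),
      Or.inr (Or.inl (SameCycle.refl _ _))⟩)
  have hrxy : r.π.SameCycle x y := by
    have key : r.π.SameCycle x y ∨ r.π.SameCycle y' y ∨ r.π.SameCycle v y := by
      rw [← hr] at hpy
      rcases (sameCycle_glue_iff hy' hx').1 hpy with h | ⟨-, h⟩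
      · exact Or.inl h
      · exact h
    rcases key with h | h | h
    · exact h
    · exact absurd ((mem_minsBelow.1 hy').1 y h) (not_le.2 hry)
    · exact absurd ((mem_minsBelow.1 hy').2 y h) (not_lt.2 hry.le)
  obtain ⟨i, hi0, hi, hij⟩ := exists_pow_mul_apply_eq (σ := q.π) (c := threeCycle x y v)
    (x := y) (y := x) (z := y)
    (fun w hw hwy => threeCycle_apply_of_ne
      (by rintro rfl; exact not_sameCycle_of_mem_minsBelow hx hw.symm) hwy
      (by rintro rfl; exact not_sameCycle_of_mem_minsBelow hy hw))
    (threeCycle_apply_fst nxy nxv) (SameCycle.refl _ _)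
  obtain ⟨j, hj0, hj, hji⟩ := exists_pow_mul_apply_eq (σ := r.π) (c := threeCycle x y' v)
    (x := x) (y := v) (z := y)
    (fun w hw hwx => threeCycle_apply_of_ne hwx
      (by rintro rfl; exact not_sameCycle_of_mem_minsBelow hx' hw)
      (by rintro rfl; exact not_sameCycle_of_mem_minsBelow (mem_minsBelow_trans hy' hx') hw))
    (threeCycle_apply_trd _ _ _) hrxy
  have e1 : q.π * threeCycle x y v = p.π := by rw [← hq]; rfl
  have e2 : r.π * threeCycle x y' v = p.π := by rw [← hr]; rfl
  rw [e1] at hi hij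
  rw [e2] at hj hji
  refine not_exists_pow_avoiding hi (z := v) (fun m hm => ?_) hj fun m hm => ?_
  · rcases Nat.eq_zero_or_pos m with rfl | hm0
    · simpa using nxv
    rcases hm.eq_or_lt with rfl | hm
    · rw [hi]; exact nyv
    · intro h
      exact not_sameCycle_of_mem_minsBelow hy (h ▸ (hij m hm0 hm).1)
  · rcases Nat.eq_zero_or_pos m with rfl | hm0
    · simpa using nxv.symm
    rcases hm.eq_or_lt with rfl | hm
    · rw [hj]; exact nxy.symm
    · exact (hji m hm0 hm).2

/-- Gluing is injective: the first point is the least element of the glued cycle, the second is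
determined by `not_position_lt_of_glue_eq`, and the block transposition can be undone. -/
theorem glue_injective {p q r : PlanePermutation n} {b v x x' y y' : Fin n}
    (hy : y ∈ q.minsBelow b v) (hx : x ∈ q.minsBelow b y)
    (hy' : y' ∈ r.minsBelow b v) (hx' : x' ∈ r.minsBelow b y')
    (hq : q.blockTranspose b x y v (position_lt_of_mem_minsBelow hx)
      (position_lt_of_mem_minsBelow hy) = p)
    (hr : r.blockTranspose b x' y' v (position_lt_of_mem_minsBelow hx')
      (position_lt_of_mem_minsBelow hy') = p) : q = r ∧ x = x' ∧ y = y' := by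
  have hxx : x = x' := by
    have m := isCycleMin_glue hy hx
    have m' := isCycleMin_glue hy' hx'
    have s := sameCycle_glue_fst_trd hy hx
    have s' := sameCycle_glue_fst_trd hy' hx'
    rw [hq] at m s
    rw [hr] at m' s'
    exact m.eq_of_sameCycle m' (s.trans s'.symm)
  subst hxx
  have hyy : y = y' := by
    apply p.position_injective b
    exact le_antisymm (not_lt.1 (not_position_lt_of_glue_eq hy' hx' hy hx hr hq))
      (not_lt.1 (not_position_lt_of_glue_eq hy hx hy' hx' hq hr))
  subst hyy
  refine ⟨?_, rfl, rfl⟩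
  rw [← hr] at hq
  have hs := congrArg PlanePermutation.s hq
  have hπ := congrArg PlanePermutation.π hq
  exact PlanePermutation.ext (mul_right_cancel hs) (mul_right_cancel hπ)

/-- Slicing: a marked anti-exceedance value `v` that is not the least element `x` of its cycle
arises by gluing. The third point is the first element after `v` on the arc of `π` from
`x` to `v`. -/
theorem exists_glue_eq {p : PlanePermutation n} {b v : Fin n} (hv : p.IsAntiExcValue b v)
    (hmin : ¬ p.IsCycleMin b v) :
    ∃ (q : PlanePermutation n) (x y : Fin n) (hy : y ∈ q.minsBelow b v)
      (hx : x ∈ q.minsBelow b y), q.IsAntiExcValue b v ∧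
      q.blockTranspose b x y v (position_lt_of_mem_minsBelow hx)
        (position_lt_of_mem_minsBelow hy) = p := by
  classical
  obtain ⟨x, hxmin, hxv⟩ := p.exists_isCycleMin b v
  have nxv : x ≠ v := by rintro rfl; exact hmin hxmin
  have hltxv : p.position b x < p.position b v :=
    lt_of_le_of_ne (hxmin v hxv) fun h => nxv (p.position_injective b h)
  -- `t` is the length of the arc from `x` to `v`, and `L` the length of the whole cycle.
  have hext : ∃ m, (p.π ^ m) x = v := by
    obtain ⟨m, -, hm⟩ := hxv.exists_pow_eq'
    exact ⟨m, hm⟩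
  have hexL : ∃ m, 0 < m ∧ (p.π ^ m) x = x := by
    obtain ⟨m, h0, -, hm⟩ := (SameCycle.refl p.π x).exists_pow_eq''
    exact ⟨m, h0, hm⟩
  set t := Nat.find hext with htdef
  have ht : (p.π ^ t) x = v := Nat.find_spec hext
  have htmin : ∀ m < t, (p.π ^ m) x ≠ v := fun m hm => Nat.find_min hext hm
  set L := Nat.find hexL with hLdef
  obtain ⟨hL0, hL⟩ : 0 < L ∧ (p.π ^ L) x = x := Nat.find_spec hexL
  have hLmin : ∀ m, 0 < m → m < L → (p.π ^ m) x ≠ x :=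
    fun m h0 hm h => Nat.find_min hexL hm ⟨h0, h⟩
  have hsub : ∀ i j, i ≤ j → (p.π ^ i) x = (p.π ^ j) x → (p.π ^ (j - i)) x = x := by
    intro i j hij h
    apply (p.π ^ i).injective
    rw [← mul_apply, ← pow_add, Nat.add_sub_cancel' hij, h]
  have hinj : ∀ i j, i < j → j - i < L → (p.π ^ i) x ≠ (p.π ^ j) x :=
    fun i j hij hl h => hLmin (j - i) (by omega) hl (hsub i j hij.le h)
  have ht0 : 0 < t := by
    rcases Nat.eq_zero_or_pos t with h | h
    · rw [h] at ht; exact absurd ht nxv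
    · exact h
  have htL : t < L := by
    by_contra hlt
    refine htmin (t - L) (by omega) ?_
    rw [← ht]
    conv_rhs => rw [← Nat.sub_add_cancel (not_lt.1 hlt), pow_add, mul_apply, hL]
  have hinvv : p.π⁻¹ v = (p.π ^ (t - 1)) x := by
    rw [inv_eq_iff_eq, ← mul_apply, ← pow_succ', Nat.sub_add_cancel ht0, ht]
  -- `r` is the index of the first element after `v` on the arc.
  obtain ⟨r, hr, hrmin⟩ := Finset.exists_min_image
    ((Finset.range t).filter fun i => p.position b v < p.position b ((p.π ^ i) x))
    (fun i => p.position b ((p.π ^ i) x)) ⟨t - 1, by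
      rw [Finset.mem_filter, Finset.mem_range]
      refine ⟨by omega, lt_of_le_of_ne (hinvv ▸ hv) fun h => ?_⟩
      exact htmin (t - 1) (by omega) (p.position_injective b h.symm)⟩
  simp only [Finset.mem_filter, Finset.mem_range] at hr hrmin
  obtain ⟨hrt, hvy⟩ := hr
  have hr0 : 0 < r := by
    rcases Nat.eq_zero_or_pos r with rfl | h
    · exact absurd hvy (not_lt.2 (by simpa using hltxv.le))
    · exact h
  obtain ⟨y, hry⟩ : ∃ y, (p.π ^ r) x = y := ⟨_, rfl⟩
  rw [hry] at hvy hrmin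
  have nvy : v ≠ y := by rintro rfl; exact lt_irrefl _ hvy
  have nxy : x ≠ y := by rintro rfl; exact lt_asymm hvy hltxv
  have carc : ∀ i, 0 < i → i < L → i ≠ r → i ≠ t →
      threeCycle x v y ((p.π ^ i) x) = (p.π ^ i) x := by
    intro i h0 hi hir hit
    refine threeCycle_apply_of_ne (hLmin i h0 hi) ?_ ?_
    · rw [← ht]
      rcases lt_or_gt_of_ne hit with h | h
      · exact hinj i t h (by omega)
      · exact (hinj t i h (by omega)).symm
    · rw [← hry]
      rcases lt_or_gt_of_ne hir with h | h
      · exact hinj i r h (by omega)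
      · exact (hinj r i h (by omega)).symm
  set q := p.blockTranspose b x v y hltxv hvy with hq
  have cycy : ∀ w, q.π.SameCycle y w → ∃ i, 0 < i ∧ i ≤ r ∧ (p.π ^ i) x = w := by
    intro w hw
    refine exists_pow_eq_of_sameCycle_mul (c := threeCycle x v y) hr0 ?_ ?_ (by rw [hry]; exact hw)
    · rw [hry, threeCycle_apply_trd, pow_zero, one_apply]
    · intro i h1 h2
      exact carc i h1 (by omega) (by omega) (by omega)
  have cycv : ∀ w, q.π.SameCycle v w → ∃ i, r < i ∧ i ≤ t ∧ (p.π ^ i) x = w := by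
    intro w hw
    refine exists_pow_eq_of_sameCycle_mul (c := threeCycle x v y) hrt ?_ ?_ (by rw [ht]; exact hw)
    · rw [ht, hry, threeCycle_apply_snd nvy nxy]
    · intro i h1 h2
      exact carc i (by omega) (by omega) (by omega) (by omega)
  have cycx : ∀ w, q.π.SameCycle x w → ∃ i, t < i ∧ i ≤ L ∧ (p.π ^ i) x = w := by
    intro w hw
    refine exists_pow_eq_of_sameCycle_mul (c := threeCycle x v y) htL ?_ ?_ (by rw [hL]; exact hw)
    · rw [hL, ht, threeCycle_apply_fst nxv nxy]
    · intro i h1 h2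
      exact carc i (by omega) (by omega) (by omega) (by omega)
  have hposx : ∀ w, p.π.SameCycle x w → q.position b x ≤ q.position b w := by
    intro w hw
    have := hxmin w hw
    simp only [hq, position_blockTranspose, blockSwap]
    split_ifs <;> omega
  -- On the arc from `x` to `v`, the element `y` is the first one after `x` in the new order.
  have hposy : ∀ i, 0 < i → i ≤ t → q.position b y ≤ q.position b ((p.π ^ i) x) := by
    intro i h0 hi
    have hxi : p.position b x < p.position b ((p.π ^ i) x) :=
      lt_of_le_of_ne (hxmin _ ⟨i, by simp⟩) fun h =>
        hLmin i h0 (by omega) (p.position_injective b h).symm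
    have hi' : p.position b ((p.π ^ i) x) ≤ p.position b v ∨
        p.position b y ≤ p.position b ((p.π ^ i) x) := by
      rcases hi.eq_or_lt with rfl | hi
      · exact Or.inl (by rw [ht])
      · rcases le_or_gt (p.position b ((p.π ^ i) x)) (p.position b v) with h | h
        · exact Or.inl h
        · exact Or.inr (hrmin i ⟨hi, h⟩)
    simp only [hq, position_blockTranspose, blockSwap]
    split_ifs <;> omega
  have hxy : q.position b x < q.position b y := q.position_injective b |>.ne nxy |>.lt_of_le
    (hposx y ⟨r, by simpa using hry⟩)
  have hymem : y ∈ q.minsBelow b v := by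
    rw [mem_minsBelow]
    refine ⟨fun w hw => ?_, fun w hw => ?_⟩
    · obtain ⟨i, h0, hi, rfl⟩ := cycy w hw
      exact hposy i h0 (by omega)
    · obtain ⟨i, h0, hi, rfl⟩ := cycv w hw
      refine lt_of_le_of_ne (hposy i (by omega) hi) fun h => ?_
      exact hinj r i h0 (by omega) (hry.trans (q.position_injective b h))
  have hxmem : x ∈ q.minsBelow b y := by
    rw [mem_minsBelow]
    refine ⟨fun w hw => ?_, fun w hw => ?_⟩
    · obtain ⟨i, h0, hi, rfl⟩ := cycx w hw
      exact hposx _ ⟨i, by simp⟩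
    · obtain ⟨i, h0, hi, rfl⟩ := cycy w hw
      exact hxy.trans_le (hposy i h0 (by omega))
  refine ⟨q, x, y, hymem, hxmem, ?_, p.blockTranspose_blockTranspose b hltxv hvy⟩
  have hinv : q.π⁻¹ v = threeCycle x y v (p.π⁻¹ v) := by
    simp only [hq, blockTranspose, mul_inv_rev, threeCycle_inv nxv nvy nxy, mul_apply]
  unfold IsAntiExcValue at hv ⊢
  rw [hinv, hinvv]
  by_cases hrt' : r = t - 1
  · rw [← hrt', hry, threeCycle_apply_snd nvy.symm nxv]
  · have hne : p.π⁻¹ v ≠ v := hinvv ▸ htmin (t - 1) (by omega)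
    have hpos : p.position b v < p.position b (p.π⁻¹ v) :=
      lt_of_le_of_ne hv fun h => hne (p.position_injective b h.symm)
    have hfix : threeCycle x y v ((p.π ^ (t - 1)) x) = (p.π ^ (t - 1)) x := by
      refine threeCycle_apply_of_ne (hLmin _ (by omega) (by omega)) ?_ (hinvv ▸ hne)
      rw [← hry]
      exact (hinj r (t - 1) (by omega) (by omega)).symm
    rw [hfix, ← hinvv]
    have hy' : p.position b y ≤ p.position b (p.π⁻¹ v) := by
      rw [hinvv] at hpos ⊢
      exact hrmin (t - 1) ⟨by omega, hpos⟩
    have hne' : p.position b y ≠ p.position b (p.π⁻¹ v) := by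
      intro h
      have := p.position_injective b h
      rw [hinvv, ← hry] at this
      exact hinj r (t - 1) (by omega) (by omega) this
    simp only [hq, position_blockTranspose, blockSwap]
    split_ifs <;> omega

end PlanePermutation

/-! ### The number of exceedances and the choice of the leftmost element -/

/-- The hockey-stick identity: count the `(j + 1)`-element subsets of `M` by their greatest
element. -/
theorem Finset.sum_choose_card_filter_lt {α : Type*} [DecidableEq α] (f : α → ℕ)
    (hf : Function.Injective f) (M : Finset α) (j : ℕ) :
    ∑ u ∈ M, ((M.filter fun w => f w < f u).card.choose j) = M.card.choose (j + 1) := by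
  induction M using Finset.induction_on_max_value f with
  | empty => simp
  | insert a s ha hmax ih =>
    have hlt : ∀ w ∈ s, f w < f a := fun w hw =>
      lt_of_le_of_ne (hmax w hw) fun h => ha (hf h ▸ hw)
    rw [Finset.sum_insert ha, Finset.card_insert_of_notMem ha, Nat.choose_succ_succ, ← ih]
    congr 1
    · rw [Finset.filter_insert, if_neg (lt_irrefl _), Finset.filter_true_of_mem hlt]
    · refine Finset.sum_congr rfl fun u hu => ?_
      rw [Finset.filter_insert, if_neg (not_lt.2 (hlt u hu).le)]

namespace PlanePermutation

open Equiv.Perm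

variable {n : ℕ}

theorem position_modEq (p : PlanePermutation n) (b x y : Fin n) :
    p.position b x + p.position x y ≡ p.position b y [MOD n] := by
  have hc : p.s.IsCycleOn (Finset.univ : Finset (Fin n)) := by simpa using p.isCycleOn
  have h1 : (p.s ^ (p.position b x + p.position x y)) b = (p.s ^ p.position b y) b := by
    rw [add_comm, pow_add, mul_apply, pow_position, pow_position, pow_position]
  simpa using (hc.pow_apply_eq_pow_apply (Finset.mem_univ b)).1 h1

theorem position_add_position (p : PlanePermutation n) (b x y : Fin n) :
    p.position b x + p.position x y =
      p.position b y + if p.position b y < p.position b x then n else 0 := by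
  have h := p.position_modEq b x y
  have h1 := p.position_lt b x
  have h2 := p.position_lt b y
  have h3 := p.position_lt x y
  unfold Nat.ModEq at h
  rw [Nat.mod_eq_of_lt h2] at h
  rcases lt_or_ge (p.position b x + p.position x y) n with hl | hl
  · rw [Nat.mod_eq_of_lt hl] at h
    rw [if_neg (by omega)]; omega
  · rw [Nat.mod_eq_sub_mod hl, Nat.mod_eq_of_lt (by omega)] at h
    rw [if_pos (by omega)]; omega

/-- Walking along `s` from each `x` to `π x`, one passes the leftmost element `b` as many times as
there are strict anti-exceedances; the total length of these walks is independent of `b`. -/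
theorem sum_position_apply (p : PlanePermutation n) (b : Fin n) :
    ∑ x, p.position x (p.π x) =
      n * (Finset.univ.filter fun x => p.position b (p.π x) < p.position b x).card := by
  have h : ∑ x, (p.position b x + p.position x (p.π x)) =
      ∑ x, (p.position b (p.π x) +
        if p.position b (p.π x) < p.position b x then n else 0) :=
    Finset.sum_congr rfl fun x _ => p.position_add_position b x (p.π x)
  rw [Finset.sum_add_distrib, Finset.sum_add_distrib, Equiv.sum_comp p.π (p.position b),
    ← Finset.sum_filter, Finset.sum_const, smul_eq_mul] at h
  rw [mul_comm]
  omega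

theorem exc_add_card (p : PlanePermutation n) (b : Fin n) :
    p.exc b + (Finset.univ.filter fun x => p.position b (p.π x) < p.position b x).card +
      (Finset.univ.filter fun x => p.π x = x).card = n := by
  classical
  have h1 := Finset.card_filter_add_card_filter_not (s := (Finset.univ : Finset (Fin n)))
    (fun x => p.position b x < p.position b (p.π x))
  have h2 := Finset.card_filter_add_card_filter_not
    (s := Finset.univ.filter fun x => ¬ p.position b x < p.position b (p.π x))
    (fun x => p.π x = x)
  rw [Finset.filter_filter, Finset.filter_filter] at h2
  have e1 : (Finset.univ.filter fun x =>
      ¬ p.position b x < p.position b (p.π x) ∧ p.π x = x) =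
      Finset.univ.filter fun x => p.π x = x := by
    ext x
    simp only [Finset.mem_filter, Finset.mem_univ, true_and, and_iff_right_iff_imp]
    intro h; rw [h]; exact lt_irrefl _
  have e2 : (Finset.univ.filter fun x =>
      ¬ p.position b x < p.position b (p.π x) ∧ ¬ p.π x = x) =
      Finset.univ.filter fun x => p.position b (p.π x) < p.position b x := by
    ext x
    simp only [Finset.mem_filter, Finset.mem_univ, true_and]
    constructor
    · rintro ⟨h, h'⟩
      exact lt_of_le_of_ne (not_lt.1 h) fun e => h' (p.position_injective b e)
    · intro h
      exact ⟨not_lt.2 h.le, fun e => absurd h (by rw [e]; exact lt_irrefl _)⟩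
  rw [e1, e2] at h2
  rw [Finset.card_univ, Fintype.card_fin] at h1
  have h3 : p.exc b =
      (Finset.univ.filter fun x => p.position b x < p.position b (p.π x)).card := by
    unfold exc before
    congr
  omega

/-- The number of exceedances does not depend on the leftmost element of `s`. -/
theorem exc_eq_exc (p : PlanePermutation n) (b b' : Fin n) : p.exc b = p.exc b' := by
  have h := (p.sum_position_apply b).symm.trans (p.sum_position_apply b')
  have h' := Nat.eq_of_mul_eq_mul_left (Nat.zero_le _ |>.trans_lt b.2) h
  have h1 := p.exc_add_card b
  have h2 := p.exc_add_card b'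
  omega

open Classical in
theorem card_isAntiExcValue (p : PlanePermutation n) (b : Fin n) :
    (Finset.univ.filter fun v => p.IsAntiExcValue b v).card + p.exc b = n := by
  have h1 := Finset.card_filter_add_card_filter_not (s := (Finset.univ : Finset (Fin n)))
    (fun v => p.IsAntiExcValue b v)
  rw [Finset.card_univ, Fintype.card_fin] at h1
  have h2 : (Finset.univ.filter fun v => ¬ p.IsAntiExcValue b v).card = p.exc b := by
    refine Finset.card_equiv p.π⁻¹ fun v => ?_
    rw [Finset.mem_filter, Finset.mem_filter]
    simp only [IsAntiExcValue, before, Finset.mem_univ, true_and, not_le]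
    rw [show p.π (p.π⁻¹ v) = v by simp]
  omega

/-! ### The recursion and the count -/

noncomputable instance : Fintype (PlanePermutation n) := Fintype.ofFinite _

section Count

variable (b : Fin n) (D : Equiv.Perm (Fin n))

open Classical in
/-- The plane permutations with diagonal `D` and `k` cycles. -/
noncomputable def withCycles (D : Equiv.Perm (Fin n)) (k : ℕ) : Finset (PlanePermutation n) :=
  Finset.univ.filter fun p => p.diagonal = D ∧ p.numCycles = k

theorem mem_withCycles {p : PlanePermutation n} {k : ℕ} :
    p ∈ withCycles D k ↔ p.diagonal = D ∧ p.numCycles = k := by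
  simp [withCycles]

theorem card_withCycles (k : ℕ) : (withCycles D k).card = countCycles D k := by
  rw [countCycles, ← Set.ncard_coe_finset]
  congr 1
  ext p
  simp [mem_withCycles]

open Classical in
/-- The least elements of the cycles of `p`. -/
noncomputable def cycleMins (p : PlanePermutation n) : Finset (Fin n) :=
  Finset.univ.filter fun v => p.IsCycleMin b v

open Classical in
/-- The anti-exceedance values of `p` that are not least elements of cycles. -/
noncomputable def nontrivialValues (p : PlanePermutation n) : Finset (Fin n) :=
  Finset.univ.filter fun v => p.IsAntiExcValue b v ∧ ¬ p.IsCycleMin b v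

open Classical in
/-- All anti-exceedance values of `p`, the least elements of cycles among them. -/
noncomputable def antiExcValues (p : PlanePermutation n) : Finset (Fin n) :=
  Finset.univ.filter fun v => p.IsAntiExcValue b v

theorem sum_antiExcValues (p : PlanePermutation n) (g : Fin n → ℕ) :
    ∑ v ∈ antiExcValues b p, g v = ∑ v ∈ cycleMins b p, g v + ∑ v ∈ nontrivialValues b p, g v := by
  classical
  rw [← Finset.sum_filter_add_sum_filter_not (antiExcValues b p) (fun v => p.IsCycleMin b v)]
  congr 1
  · refine Finset.sum_congr ?_ fun _ _ => rfl
    ext v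
    simp only [antiExcValues, cycleMins, Finset.mem_filter, Finset.mem_univ, true_and,
      and_iff_right_iff_imp]
    exact IsCycleMin.isAntiExcValue
  · refine Finset.sum_congr ?_ fun _ _ => rfl
    ext v
    simp [antiExcValues, nontrivialValues]

theorem card_nontrivialValues (p : PlanePermutation n) :
    (nontrivialValues b p).card + p.numCycles + p.exc b = n := by
  have h := sum_antiExcValues b p fun _ => 1
  simp only [Finset.sum_const, smul_eq_mul, mul_one] at h
  have h1 : (cycleMins b p).card = p.numCycles := (p.numCycles_eq_card b).symm
  have h2 : (antiExcValues b p).card + p.exc b = n := p.card_isAntiExcValue b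
  omega

/-- Choosing `y` before the cycle of `v`, and `j` cycles before `y`, amounts to choosing `j + 1`
cycles before that of `v`. -/
theorem sum_minsBelow_choose (p : PlanePermutation n) (v : Fin n) (j : ℕ) :
    ∑ y ∈ p.minsBelow b v, (p.minsBelow b y).card.choose j =
      (p.minsBelow b v).card.choose (j + 1) := by
  classical
  rw [← Finset.sum_choose_card_filter_lt (p.position b) (p.position_injective b)]
  refine Finset.sum_congr rfl fun y hy => ?_
  congr 2
  ext u
  rw [Finset.mem_filter]
  constructor
  · intro hu
    exact ⟨mem_minsBelow_trans hy hu, position_lt_of_mem_minsBelow hu⟩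
  · rintro ⟨hu, huy⟩
    exact mem_minsBelow.2 ⟨(mem_minsBelow.1 hu).1, fun w hw =>
      huy.trans_le ((mem_minsBelow.1 hy).1 w hw)⟩

theorem sum_cycleMins_choose (p : PlanePermutation n) (j : ℕ) :
    ∑ v ∈ cycleMins b p, (p.minsBelow b v).card.choose j = p.numCycles.choose (j + 1) := by
  classical
  rw [p.numCycles_eq_card b,
    ← Finset.sum_choose_card_filter_lt (p.position b) (p.position_injective b)]
  refine Finset.sum_congr rfl fun v hv => ?_
  have hv : p.IsCycleMin b v := (Finset.mem_filter.1 hv).2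
  congr 2
  ext u
  simp only [Finset.mem_filter, Finset.mem_univ, true_and]
  constructor
  · intro hu
    exact ⟨(mem_minsBelow.1 hu).1, position_lt_of_mem_minsBelow hu⟩
  · rintro ⟨hu, huv⟩
    exact mem_minsBelow.2 ⟨hu, fun w hw => huv.trans_le (hv w hw)⟩

/-- The weighted number of plane permutations with diagonal `D`, `k` cycles and a marked nontrivial
anti-exceedance value `v`. The weight is the number of ways to choose `j` cycles that lie, with
their least elements, before the cycle of `v`. -/
noncomputable def markedCount (k j : ℕ) : ℕ :=
  ∑ p ∈ withCycles D k, ∑ v ∈ nontrivialValues b p, (p.minsBelow b v).card.choose j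

/-- The gluing bijection: the marked value `v` may be any anti-exceedance value on the other side,
and the two further cycles come from before the cycle of `v`. -/
theorem markedCount_eq_sum (k j : ℕ) :
    markedCount b D k j =
      ∑ q ∈ withCycles D (k + 2), ∑ v ∈ antiExcValues b q, ∑ y ∈ q.minsBelow b v,
        ∑ x ∈ q.minsBelow b y, (q.minsBelow b x).card.choose j := by
  classical
  unfold markedCount
  simp_rw [Finset.sum_sigma']
  symm
  refine Finset.sum_bij (fun a ha => ⟨a.1.blockTranspose b a.2.2.2 a.2.2.1 a.2.1
    (position_lt_of_mem_minsBelow (Finset.mem_sigma.1 (Finset.mem_sigma.1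
      (Finset.mem_sigma.1 ha).2).2).2)
    (position_lt_of_mem_minsBelow (Finset.mem_sigma.1 (Finset.mem_sigma.1
      (Finset.mem_sigma.1 ha).2).2).1), a.2.1⟩) ?_ ?_ ?_ ?_
  · rintro ⟨q, v, y, x⟩ ha
    simp only [Finset.mem_sigma, antiExcValues, Finset.mem_filter, Finset.mem_univ, true_and,
      mem_withCycles] at ha
    obtain ⟨⟨hD, hk⟩, hv, hy, hx⟩ := ha
    simp only [Finset.mem_sigma, nontrivialValues, Finset.mem_filter, Finset.mem_univ, true_and,
      mem_withCycles]
    have := numCycles_glue hy hx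
    exact ⟨⟨(q.diagonal_blockTranspose b _ _).trans hD, by omega⟩,
      isAntiExcValue_glue hy hx hv, not_isCycleMin_glue hy hx⟩
  · rintro ⟨q, v, y, x⟩ ha ⟨r, v', y', x'⟩ ha' h
    simp only [Finset.mem_sigma] at ha ha'
    obtain ⟨-, -, hy, hx⟩ := ha
    obtain ⟨-, -, hy', hx'⟩ := ha'
    simp only [Sigma.mk.injEq, heq_eq_eq] at h
    obtain ⟨h, rfl⟩ := h
    obtain ⟨rfl, rfl, rfl⟩ := glue_injective hy hx hy' hx' h rfl
    rfl
  · rintro ⟨p, v⟩ ha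
    simp only [Finset.mem_sigma, nontrivialValues, Finset.mem_filter, Finset.mem_univ, true_and,
      mem_withCycles] at ha
    obtain ⟨⟨hD, hk⟩, hv, hmin⟩ := ha
    obtain ⟨q, x, y, hy, hx, hqv, rfl⟩ := exists_glue_eq hv hmin
    have := numCycles_glue hy hx
    rw [diagonal_blockTranspose] at hD
    refine ⟨⟨q, v, y, x⟩, ?_, rfl⟩
    simp only [Finset.mem_sigma, antiExcValues, Finset.mem_filter, Finset.mem_univ, true_and,
      mem_withCycles]
    exact ⟨⟨hD, by omega⟩, hqv, hy, hx⟩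
  · rintro ⟨q, v, y, x⟩ ha
    simp only [Finset.mem_sigma] at ha
    obtain ⟨-, -, hy, hx⟩ := ha
    simp only [minsBelow_glue hy hx]

/-- The values `v` that are least elements of cycles contribute a choice of `j + 3` cycles; the
others are again counted by `markedCount`. -/
theorem markedCount_eq (k j : ℕ) :
    markedCount b D k j =
      (k + 2).choose (j + 3) * countCycles D (k + 2) + markedCount b D (k + 2) (j + 2) := by
  rw [markedCount_eq_sum]
  simp_rw [sum_minsBelow_choose, sum_antiExcValues, sum_cycleMins_choose]
  rw [Finset.sum_add_distrib, ← card_withCycles, mul_comm, ← smul_eq_mul, ← Finset.sum_const]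
  congr 1
  exact Finset.sum_congr rfl fun p hp => by rw [((mem_withCycles D).1 hp).2]

theorem markedCount_eq_zero {k : ℕ} (j : ℕ) (hk : n < k) : markedCount b D k j = 0 := by
  have h : withCycles D k = ∅ := by
    rw [← Finset.card_eq_zero, card_withCycles, countCycles_eq_zero D hk]
  rw [markedCount, h, Finset.sum_empty]

theorem markedCount_eq_sum_range (N k j : ℕ) :
    markedCount b D k j =
      ∑ i ∈ Finset.range N,
        (k + 2 * (i + 1)).choose (j + 2 * (i + 1) + 1) * countCycles D (k + 2 * (i + 1)) +
      markedCount b D (k + 2 * N) (j + 2 * N) := by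
  induction N with
  | zero => simp
  | succ N ih =>
    rw [ih, markedCount_eq b D (k + 2 * N), Finset.sum_range_succ, ← add_assoc]
    rfl

end Count

/-- The factor `n - a - k` is the number of nontrivial anti-exceedance values. -/
theorem finsum_countExcCycles (base : PlanePermutation n → Fin n) (b : Fin n)
    (D : Equiv.Perm (Fin n)) (k : ℕ) :
    (∑ᶠ a : ℕ, ((n : ℤ) - (a : ℤ) - (k : ℤ)) * (countExcCycles base D a k : ℤ)) =
      markedCount b D k 0 := by
  classical
  have hcount : ∀ a, countExcCycles base D a k =
      ((withCycles D k).filter fun p => p.exc b = a).card := by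
    intro a
    rw [countExcCycles, ← Set.ncard_coe_finset]
    congr 1
    ext p
    simp only [Set.mem_ofPred_eq, Finset.coe_filter, mem_withCycles, and_assoc,
      p.exc_eq_exc (base p) b]
  rw [finsum_eq_sum_of_support_subset (s := Finset.range (n + 1))]
  · have hmaps : ∀ p ∈ withCycles D k, p.exc b ∈ Finset.range (n + 1) := fun p _ =>
      Finset.mem_range.2 (Nat.lt_succ_of_le (p.exc_le b))
    have hL : (markedCount b D k 0 : ℤ) =
        ∑ p ∈ withCycles D k, ((n : ℤ) - (p.exc b : ℤ) - (k : ℤ)) := by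
      unfold markedCount
      push_cast
      refine Finset.sum_congr rfl fun p hp => ?_
      have h1 := card_nontrivialValues b p
      have h2 := ((mem_withCycles D).1 hp).2
      simp only [Nat.choose_zero_right, Nat.cast_one, Finset.sum_const, nsmul_eq_mul, mul_one]
      omega
    rw [hL, ← Finset.sum_fiberwise_of_maps_to hmaps]
    refine Finset.sum_congr rfl fun a _ => ?_
    rw [hcount, mul_comm, ← nsmul_eq_mul, ← Finset.sum_const]
    refine Finset.sum_congr rfl fun p hp => ?_
    rw [(Finset.mem_filter.1 hp).2]
  · intro a ha
    rw [Function.mem_support] at ha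
    by_contra h
    refine ha ?_
    rw [countExcCycles_eq_zero base D k (by simpa using h), Nat.cast_zero, mul_zero]

end PlanePermutation

theorem mainTheorem2 (n : ℕ) (base : PlanePermutation n → Fin n)
    (D : Equiv.Perm (Fin n)) (k : ℕ) (hk : 1 ≤ k) :
    (∑ᶠ a : ℕ, ((n : ℤ) - (a : ℤ) - (k : ℤ)) *
        (PlanePermutation.countExcCycles base D a k : ℤ)) =
      ∑ᶠ (i : ℕ) (_ : 1 ≤ i),
        ((k + 2 * i).choose (k - 1) : ℤ) *
          (PlanePermutation.countCycles D (k + 2 * i) : ℤ) := by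
  -- For `n = 0` there is no function `base`, as the empty plane permutation would need a value.
  have hn : 0 < n := by
    rcases Nat.eq_zero_or_pos n with rfl | h
    · exact (base ⟨1, 1, by simp [Equiv.Perm.IsCycleOn]⟩).elim0
    · exact h
  rw [PlanePermutation.finsum_countExcCycles base ⟨0, hn⟩,
    PlanePermutation.markedCount_eq_sum_range _ D n k 0,
    PlanePermutation.markedCount_eq_zero _ D _ (by omega : n < k + 2 * n), add_zero]
  rw [finsum_cond_eq_sum_of_cond_iff (t := Finset.Ico 1 (n + 1)) _ fun {i} hi => ?_]
  · rw [Finset.sum_Ico_eq_sum_range, Nat.add_sub_cancel, Nat.cast_sum]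
    refine Finset.sum_congr rfl fun i _ => ?_
    rw [add_comm 1 i, Nat.choose_symm_of_eq_add (n := k + 2 * (i + 1)) (a := k - 1)
      (b := 0 + 2 * (i + 1) + 1) (by omega), Nat.cast_mul]
  · have : k + 2 * i ≤ n := by
      by_contra h
      exact hi (by rw [PlanePermutation.countCycles_eq_zero D (not_le.1 h), Nat.cast_zero,
        mul_zero])
    rw [Finset.mem_Ico]
    omega
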